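/- Lemma 4.4 (lem:fixpoint). Let $\sigma:\mathbb R\to\mathbb R$ be measurable with $\langle\sigma^2\rangle<\infty$, where $\langle f\rangle=\mathbb E_{z\sim\mathcal N(0,1)}[f(z)]$, and suppose that $\sigma$ is nonaffine, meaning that it does not agree almost everywhere with any function $z\mapsto az+b$. For $k\in[-1,1]$ let $$\mathcal C(k)=\frac{\mathbb E[\sigma(z_1)\sigma(z_2)]}{\langle\sigma^2\rangle},$$ where $(z_1,z_2)$ is a centred (for $k=\pm1$ degenerate) Gaussian pair with unit variances and covariance $k$. Let $\mathrm{He}_n$ be the probabilists' Hermite polynomials and $a_n=\langle\sigma\,\mathrm{He}_n\rangle/n!$. Then $$\mathcal C(k)=\frac1{\langle\sigma^2\rangle}\sum_{n=0}^\infty a_n^2\,n!\,k^n\qquad(k\in[-1,1]).$$ Moreover, there is a fixed point $k^*\in[0,1]$ of $\mathcal C$ such that, for every $k_0\in(-1,1)$, the iterates $\mathcal C^{m}(k_0)$ converge to $k^*$ as $m\to\infty$. It is unique in the sense that it does not depend on $k_0$ and $\mathcal C$ has no fixed point in $(-1,1)$ other than possibly $k^*$. Finally, $k^*=0$ if and only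 if $\langle\sigma\rangle=0$. -/

import Mathlib

open MeasureTheory ProbabilityTheory Filter Topology

noncomputable section

/-- The Gaussian expectation `⟨f(z)⟩` of a function of one standard Gaussian variable. -/
def gaussMean (f : ℝ → ℝ) : ℝ := ∫ z, f z ∂(gaussianReal 0 1)

/-- The matrix `Σ` with unit diagonal entries and off-diagonal entries `k`. -/
def covMatrix (k : ℝ) : Matrix (Fin 2) (Fin 2) ℝ := !![1, k; k, 1]

/-- The Gaussian expectation `⟨f(z₁, z₂)⟩_Σ` over a centred Gaussian pair with unit variances
and covariance `k`, for `k ∈ [-1, 1]`. At `k = 1` and `k = -1` the Gaussian is degenerate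
(`z₂ = z₁`, respectively `z₂ = -z₁`, almost surely). -/
def gaussPairMean (k : ℝ) (f : ℝ → ℝ → ℝ) : ℝ :=
  ∫ z, f (z 0) (z 1) ∂(multivariateGaussian (0 : EuclideanSpace ℝ (Fin 2)) (covMatrix k))

/-- The covariance map `𝒞(k) = ⟨σ(z₁) σ(z₂)⟩_Σ / ⟨σ(z)²⟩`, meaningful for `k ∈ [-1, 1]`. -/
def covMap (σ : ℝ → ℝ) (k : ℝ) : ℝ :=
  gaussPairMean k (fun z₁ z₂ => σ z₁ * σ z₂) / gaussMean (fun z => σ z ^ 2)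

/-- The Hermite coefficient `a_n = ⟨σ(z) He_n(z)⟩ / n!`, for the probabilists' Hermite
polynomial `He_n` (whose squared norm under the Gaussian measure is `n!`). -/
def hermiteCoeff (σ : ℝ → ℝ) (n : ℕ) : ℝ :=
  gaussMean (fun z => σ z * Polynomial.aeval z (Polynomial.hermite n)) / (n.factorial : ℝ)

end

/-! ### Hermite polynomials in the Gaussian `L²` space. -/

section GaussianHermite

open Polynomial
open scoped Matrix

/-! Realize the pair as `(x, k x + s w)` with `x, w` independent and `k² + s² = 1`. Averaging over
`w` multiplies `He_n` by `k^n` (`integral_realHermite_affine`), so correlation acts diagonally on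
the Hermite basis, which is complete by a Fourier argument (`hermiteBasis`). This gives the series
(`hasSum_integral_prod_mul`).

After normalization the coefficients `p n` are nonnegative and sum to `C 1 = 1`. Nonaffinity gives
`p j > 0` for some `j ≥ 2`, so `C` is monotone and strictly convex on `[0, 1]`. Hence it has at most
one fixed point below `1`, with the graph above the diagonal before it and below after it; if there
is none, `1` attracts. Monotone iteration gives convergence on `[0, 1)`. For `-1 < k < 0`, `C k >
k`, so an orbit either reaches `[0, 1)` or increases to a fixed point in `(-1, 0]`, which uniqueness
identifies. Finally `C 0` is a positive multiple of `⟨σ⟩²`. -/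

theorem integrable_eval_gaussianReal (p : ℝ[X]) :
    Integrable (fun x => p.eval x) (gaussianReal 0 1) := by
  induction p using Polynomial.induction_on' with
  | add p q hp hq =>
    simp only [eval_add]
    exact hp.add hq
  | monomial n a =>
    have h : Integrable (fun x : ℝ => x ^ n) (gaussianReal 0 1) :=
      integrable_pow_of_integrable_exp_mul (X := id) (t := 1) one_ne_zero
        (integrable_exp_mul_gaussianReal 1) (integrable_exp_mul_gaussianReal (-1)) n
    simpa using h.const_mul a

theorem memLp_eval_gaussianReal (p : ℝ[X]) :
    MemLp (fun x => p.eval x) 2 (gaussianReal 0 1) := by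
  rw [memLp_two_iff_integrable_sq (by fun_prop)]
  simp only [← eval_pow]
  exact integrable_eval_gaussianReal (p ^ 2)

/-- Gaussian integration by parts for polynomials. -/
theorem integral_mul_eval_gaussianReal (p : ℝ[X]) :
    ∫ x, x * p.eval x ∂(gaussianReal 0 1) = ∫ x, p.derivative.eval x ∂(gaussianReal 0 1) := by
  have key (q : ℝ[X]) : Integrable fun x => gaussianPDFReal 0 1 x * q.eval x := by
    have := integrable_eval_gaussianReal q
    rw [gaussianReal_of_var_ne_zero _ one_ne_zero,
      integrable_withDensity_iff_integrable_smul' (by fun_prop)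
        (ae_of_all _ fun _ => gaussianPDF_lt_top)] at this
    simpa [toReal_gaussianPDF] using this
  have hd (x : ℝ) : HasDerivAt (fun x => gaussianPDFReal 0 1 x * p.eval x)
      (gaussianPDFReal 0 1 x * (p.derivative - X * p).eval x) x := by
    have h1 : HasDerivAt (gaussianPDFReal 0 1) (-x * gaussianPDFReal 0 1 x) x := by
      have h2 : HasDerivAt (fun x : ℝ => -x ^ 2 / 2) (-x) x := by
        refine HasDerivAt.congr_deriv (((hasDerivAt_pow 2 x).fun_neg).div_const 2) ?_
        simp only [Nat.cast_ofNat, Nat.add_one_sub_one, pow_one]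
        ring
      have := h2.exp.const_mul (√(2 * Real.pi))⁻¹
      rw [gaussianPDFReal_def]
      simp only [NNReal.coe_one, mul_one, sub_zero]
      exact this.congr_deriv (by ring)
    refine (h1.fun_mul (p.hasDerivAt x)).congr_deriv ?_
    simp only [eval_sub, eval_mul, eval_X]
    ring
  have h0 := integral_eq_zero_of_hasDerivAt_of_integrable hd (key _) (key _)
  have h1 : ∫ x, (p.derivative - X * p).eval x ∂(gaussianReal 0 1) = 0 := by
    rw [integral_gaussianReal_eq_integral_smul one_ne_zero]
    simpa using h0
  have hX := integrable_eval_gaussianReal (X * p)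
  simp only [eval_sub, eval_mul, eval_X] at h1 hX
  rw [integral_sub (integrable_eval_gaussianReal _) hX] at h1
  linarith

/-- The Hermite polynomials with real coefficients. -/
noncomputable def realHermite (n : ℕ) : ℝ[X] := (hermite n).map (Int.castRingHom ℝ)

theorem aeval_hermite_eq_eval (n : ℕ) (x : ℝ) :
    aeval x (hermite n) = (realHermite n).eval x := by
  rw [realHermite, eval_map, aeval_def]; rfl

@[simp] theorem realHermite_zero : realHermite 0 = 1 := by simp [realHermite]

theorem realHermite_succ (n : ℕ) :
    realHermite (n + 1) = X * realHermite n - derivative (realHermite n) := by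
  simp [realHermite, hermite_succ, derivative_map]

@[simp] theorem realHermite_one : realHermite 1 = X := by simp [realHermite]

theorem derivative_realHermite_succ (n : ℕ) :
    derivative (realHermite (n + 1)) = (n + 1 : ℝ[X]) * realHermite n := by
  induction n with
  | zero => simp
  | succ n ih =>
    rw [realHermite_succ (n + 1), derivative_sub, derivative_mul, ih]
    have h : derivative ((n + 1 : ℝ[X]) * realHermite n)
        = (n + 1 : ℝ[X]) * derivative (realHermite n) := by
      simp [derivative_mul]
    rw [h, realHermite_succ n]
    simp only [derivative_X]
    push_cast
    ring

/-- Integration by parts makes `q ↦ X q - q'`, which raises `He_n` to `He_{n+1}`, adjoint to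
differentiation. Orthogonality follows by lowering both indices. -/
theorem integral_realHermite_succ_mul (n : ℕ) (q : ℝ[X]) :
    ∫ x, (realHermite (n + 1)).eval x * q.eval x ∂(gaussianReal 0 1)
      = ∫ x, (realHermite n).eval x * q.derivative.eval x ∂(gaussianReal 0 1) := by
  have h := integral_mul_eval_gaussianReal (realHermite n * q)
  simp only [derivative_mul, eval_add, eval_mul] at h
  have i1 := integrable_eval_gaussianReal (derivative (realHermite n) * q)
  have i2 := integrable_eval_gaussianReal (realHermite n * derivative q)
  have i3 := integrable_eval_gaussianReal (X * (realHermite n * q))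
  simp only [eval_mul, eval_X] at i1 i2 i3
  rw [integral_add i1 i2] at h
  have : ∀ x, (realHermite (n + 1)).eval x * q.eval x
      = x * ((realHermite n).eval x * q.eval x)
        - (derivative (realHermite n)).eval x * q.eval x := by
    intro x; rw [realHermite_succ]; simp; ring
  simp_rw [this]
  rw [integral_sub i3 i1, h]
  ring

theorem integral_realHermite_mul_realHermite (m n : ℕ) :
    ∫ x, (realHermite m).eval x * (realHermite n).eval x ∂(gaussianReal 0 1)
      = if m = n then (n.factorial : ℝ) else 0 := by
  induction m generalizing n with
  | zero =>
    cases n with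
    | zero => simp
    | succ n =>
      have := integral_realHermite_succ_mul n 1
      simpa using this
  | succ m ih =>
    rw [integral_realHermite_succ_mul]
    cases n with
    | zero => simp
    | succ n =>
      have h : ∀ x, (realHermite m).eval x * (derivative (realHermite (n + 1))).eval x
          = (n + 1 : ℝ) * ((realHermite m).eval x * (realHermite n).eval x) := by
        intro x; rw [derivative_realHermite_succ]; simp; ring
      simp_rw [h]
      rw [integral_const_mul, ih]
      by_cases hmn : m = n <;> simp [hmn, Nat.factorial_succ]

theorem integrable_eval_affine (p : ℝ[X]) (a s : ℝ) :
    Integrable (fun w => p.eval (a + s * w)) (gaussianReal 0 1) := by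
  have h := integrable_eval_gaussianReal (p.comp (C a + C s * X))
  simpa only [eval_comp, eval_add, eval_mul, eval_C, eval_X] using h

/-- The Hermite polynomials are eigenfunctions of the Mehler (noise) operator. -/
theorem integral_realHermite_affine {k s : ℝ} (hks : k ^ 2 + s ^ 2 = 1) (x : ℝ) (n : ℕ) :
    ∫ w, (realHermite n).eval (k * x + s * w) ∂(gaussianReal 0 1)
      = k ^ n * (realHermite n).eval x := by
  induction n using Nat.strong_induction_on with
  | _ n ih =>
  match n with
  | 0 => simp
  | n + 1 =>
    have hst := integral_mul_eval_gaussianReal ((realHermite n).comp (C (k * x) + C s * X))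
    have hX := integrable_eval_gaussianReal (X * ((realHermite n).comp (C (k * x) + C s * X)))
    simp only [derivative_comp, eval_mul, eval_comp, eval_add, eval_C, eval_X, derivative_add,
      derivative_C, derivative_mul, derivative_X, zero_mul, zero_add, mul_one] at hst hX
    rw [integral_const_mul] at hst
    have i1 := integrable_eval_affine (realHermite n) (k * x) s
    have i2 := integrable_eval_affine (derivative (realHermite n)) (k * x) s
    have h : ∀ w, (realHermite (n + 1)).eval (k * x + s * w)
        = (k * x * (realHermite n).eval (k * x + s * w)
          + s * (w * (realHermite n).eval (k * x + s * w)))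
          - (derivative (realHermite n)).eval (k * x + s * w) := by
      intro w; rw [realHermite_succ]; simp; ring
    simp_rw [h]
    rw [integral_sub ((i1.const_mul _).fun_add (hX.const_mul _)) i2,
      integral_add (i1.const_mul _) (hX.const_mul _), integral_const_mul, integral_const_mul,
      hst, ih n (by omega), realHermite_succ]
    -- Since `He_n' = n He_{n-1}`, the induction hypothesis two degrees down applies; the factor `k`
    -- makes up for the lost degree. The derivative terms then combine through `s² - 1 = -k²`.
    have hD : (∫ w, (derivative (realHermite n)).eval (k * x + s * w) ∂(gaussianReal 0 1)) * k
        = k ^ n * (derivative (realHermite n)).eval x := by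
      match n with
      | 0 => simp
      | n + 1 =>
        simp only [derivative_realHermite_succ, eval_mul, eval_add, eval_natCast, eval_one]
        rw [integral_const_mul, ih n (by omega)]
        ring
    simp only [eval_sub, eval_mul, eval_X]
    linear_combination (∫ w, (derivative (realHermite n)).eval (k * x + s * w)
      ∂(gaussianReal 0 1)) * hks - k * hD

/-- An integrable function all of whose Fourier integrals vanish is almost everywhere zero. -/
theorem MeasureTheory.Integrable.ae_eq_zero_of_integral_cexp_mul_eq_zero
    {μ : Measure ℝ} {f : ℝ → ℝ} (hf : Integrable f μ)
    (h : ∀ t : ℝ, ∫ x, Complex.exp (t * x * Complex.I) * f x ∂μ = 0) : f =ᵐ[μ] 0 := by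
  have hp : AEMeasurable (fun x => ENNReal.ofReal (f x)) μ := hf.aemeasurable.ennreal_ofReal
  have hn : AEMeasurable (fun x => ENNReal.ofReal (-f x)) μ := hf.aemeasurable.neg.ennreal_ofReal
  have fp : IsFiniteMeasure (μ.withDensity fun x => ENNReal.ofReal (f x)) :=
    isFiniteMeasure_withDensity_ofReal hf.2
  have fn : IsFiniteMeasure (μ.withDensity fun x => ENNReal.ofReal (-f x)) :=
    isFiniteMeasure_withDensity_ofReal hf.neg.2
  -- The positive and negative parts of `f` give finite measures with the same characteristic
  -- function.
  have key : (μ.withDensity fun x => ENNReal.ofReal (f x))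
      = μ.withDensity fun x => ENNReal.ofReal (-f x) := by
    refine Measure.ext_of_charFun (funext fun t => ?_)
    have hexp : AEStronglyMeasurable (fun x : ℝ => Complex.exp (t * x * Complex.I)) μ := by
      fun_prop
    rw [charFun_apply_real, charFun_apply_real,
      integral_withDensity_eq_integral_toReal_smul₀ hp (by simp),
      integral_withDensity_eq_integral_toReal_smul₀ hn (by simp), ← sub_eq_zero, ← integral_sub]
    · rw [← h t]
      refine integral_congr_ae (ae_of_all _ fun x => ?_)
      simp only [ENNReal.toReal_ofReal', Complex.real_smul]
      rw [← sub_mul, mul_comm, ← Complex.ofReal_sub, 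
        max_zero_sub_max_neg_zero_eq_self]
    · refine hf.mono (hp.ennreal_toReal.aestronglyMeasurable.smul hexp) (ae_of_all _ fun x => ?_)
      rw [norm_smul, ← Complex.ofReal_mul, Complex.norm_exp_ofReal_mul_I, mul_one,
        ENNReal.toReal_ofReal', Real.norm_of_nonneg (le_max_right _ _)]
      exact max_le (le_abs_self _) (abs_nonneg _)
    · refine hf.mono (hn.ennreal_toReal.aestronglyMeasurable.smul hexp) (ae_of_all _ fun x => ?_)
      rw [norm_smul, ← Complex.ofReal_mul, Complex.norm_exp_ofReal_mul_I, mul_one,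
        ENNReal.toReal_ofReal', Real.norm_of_nonneg (le_max_right _ _)]
      exact max_le (neg_le_abs _) (abs_nonneg _)
  have := (withDensity_eq_iff hp hn hf.lintegral_lt_top.ne).1 key
  filter_upwards [this] with x hx
  rcases le_total (f x) 0 with h0 | h0
  · rw [ENNReal.ofReal_of_nonpos h0, eq_comm, ENNReal.ofReal_eq_zero] at hx
    exact le_antisymm h0 (by simpa using hx)
  · rw [ENNReal.ofReal_of_nonpos (neg_nonpos.2 h0), ENNReal.ofReal_eq_zero] at hx
    exact le_antisymm hx h0

/-- Paired with `f ∈ L²`, this yields the integrable bound `exp |t x| * |f x|` for integrating the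
exponential series termwise. -/
theorem memLp_exp_abs_gaussianReal (t : ℝ) :
    MemLp (fun x => Real.exp (|t * x|)) 2 (gaussianReal 0 1) := by
  rw [memLp_two_iff_integrable_sq (by fun_prop)]
  refine ((integrable_exp_mul_gaussianReal (2 * t)).add
    (integrable_exp_mul_gaussianReal (-(2 * t)))).mono' (by fun_prop) (ae_of_all _ fun x => ?_)
  rw [Real.norm_of_nonneg (by positivity), ← Real.exp_nat_mul]
  simp only [Pi.add_apply]
  rcases abs_cases (t * x) with ⟨h, -⟩ | ⟨h, -⟩ <;> rw [h]
  · refine le_add_of_le_of_nonneg (Real.exp_le_exp.2 (le_of_eq ?_)) (by positivity)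
    push_cast; ring
  · refine le_add_of_nonneg_of_le (by positivity) (Real.exp_le_exp.2 (le_of_eq ?_))
    push_cast; ring

/-- Polynomials are complete in `L²` of the Gaussian measure. -/
theorem MeasureTheory.MemLp.ae_eq_zero_of_integral_pow_mul_eq_zero {f : ℝ → ℝ}
    (hf : MemLp f 2 (gaussianReal 0 1))
    (h : ∀ n : ℕ, ∫ x, x ^ n * f x ∂(gaussianReal 0 1) = 0) : f =ᵐ[gaussianReal 0 1] 0 := by
  refine (hf.integrable (by norm_num)).ae_eq_zero_of_integral_cexp_mul_eq_zero fun t => ?_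
  have hsum : ∀ x : ℝ, HasSum (fun n : ℕ => (|t * x|) ^ n / n.factorial * |f x|)
      (Real.exp (|t * x|) * |f x|) := fun x => by
    rw [Real.exp_eq_exp_ℝ]
    exact (NormedSpace.expSeries_div_hasSum_exp (|t * x|)).mul_right _
  have H := hasSum_integral_of_dominated_convergence (μ := gaussianReal 0 1)
    (F := fun (n : ℕ) (x : ℝ) => (t * x * Complex.I) ^ n / n.factorial * (f x : ℂ))
    (f := fun x => Complex.exp (t * x * Complex.I) * f x)
    (fun (n : ℕ) (x : ℝ) => (|t * x|) ^ n / n.factorial * |f x|)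
    (fun n => by
      exact AEStronglyMeasurable.mul (by fun_prop)
        (Complex.continuous_ofReal.comp_aestronglyMeasurable hf.1))
    (fun n => ae_of_all _ fun x => by simp [abs_mul])
    (ae_of_all _ fun x => (hsum x).summable)
    (by
      simp_rw [fun x => (hsum x).tsum_eq]
      exact (memLp_exp_abs_gaussianReal t).integrable_mul hf.abs)
    (ae_of_all _ fun x => by
      rw [Complex.exp_eq_exp_ℂ]
      exact (NormedSpace.expSeries_div_hasSum_exp ((t : ℂ) * x * Complex.I)).mul_right _)
  have hz : (fun n : ℕ => ∫ x, ((t : ℂ) * x * Complex.I) ^ n / n.factorial * (f x : ℂ)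
      ∂(gaussianReal 0 1)) = fun _ => 0 := by
    funext n
    have : ∀ x : ℝ, ((t : ℂ) * x * Complex.I) ^ n / n.factorial * (f x : ℂ)
        = ((t : ℂ) * Complex.I) ^ n / n.factorial * ((x ^ n * f x : ℝ) : ℂ) := by
      intro x; push_cast; ring
    simp_rw [this]
    rw [integral_const_mul, integral_complex_ofReal, h n]
    simp
  rw [hz] at H
  exact H.unique hasSum_zero

theorem integrable_eval_mul_gaussianReal {f : ℝ → ℝ} (hf : MemLp f 2 (gaussianReal 0 1))
    (p : ℝ[X]) : Integrable (fun x => p.eval x * f x) (gaussianReal 0 1) :=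
  (memLp_eval_gaussianReal p).integrable_mul hf

/-- As `He_d` is monic of degree `d`, subtracting a multiple of it cancels the leading term and
lowers the degree. -/
theorem integral_eval_mul_eq_zero_of_realHermite {f : ℝ → ℝ}
    (hf : MemLp f 2 (gaussianReal 0 1))
    (h : ∀ n, ∫ x, (realHermite n).eval x * f x ∂(gaussianReal 0 1) = 0) (p : ℝ[X]) :
    ∫ x, p.eval x * f x ∂(gaussianReal 0 1) = 0 := by
  induction hd : p.natDegree using Nat.strong_induction_on generalizing p with
  | _ d ih =>
  set r := p - C p.leadingCoeff * realHermite d with hr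
  have hpr : p = C p.leadingCoeff * realHermite d + r := by rw [hr]; ring
  have hr0 : ∫ x, r.eval x * f x ∂(gaussianReal 0 1) = 0 := by
    by_cases hr00 : r = 0
    · simp [hr00]
    have hp0 : p ≠ 0 := fun h0 => hr00 (by simp [hr, h0])
    have hlc : p.leadingCoeff ≠ 0 := leadingCoeff_ne_zero.2 hp0
    refine ih r.natDegree ?_ r rfl
    rw [← hd]
    refine natDegree_lt_natDegree hr00 (degree_sub_lt_left ?_ hp0 ?_)
    · rw [degree_C_mul hlc, realHermite, (hermite_monic d).degree_map, degree_hermite,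
        degree_eq_natDegree hp0, hd]
    · rw [leadingCoeff_mul, leadingCoeff_C, realHermite,
        ((hermite_monic d).map _).leadingCoeff, mul_one]
  rw [hpr]
  simp only [eval_add, eval_mul, eval_C, add_mul, mul_assoc]
  rw [integral_add ((integrable_eval_mul_gaussianReal hf _).const_mul _)
    (integrable_eval_mul_gaussianReal hf _), integral_const_mul, h, hr0]
  simp

/-- The normalized Hermite polynomials as elements of `L²` of the Gaussian measure. -/
noncomputable def hermiteLp (n : ℕ) : Lp ℝ 2 (gaussianReal 0 1) :=
  (√(n.factorial : ℝ))⁻¹ • (memLp_eval_gaussianReal (realHermite n)).toLp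

theorem coeFn_hermiteLp (n : ℕ) :
    hermiteLp n =ᵐ[gaussianReal 0 1] fun x => (√(n.factorial : ℝ))⁻¹ * (realHermite n).eval x := by
  filter_upwards [Lp.coeFn_smul (√(n.factorial : ℝ))⁻¹
    (memLp_eval_gaussianReal (realHermite n)).toLp,
    (memLp_eval_gaussianReal (realHermite n)).coeFn_toLp] with x h1 h2
  rw [hermiteLp, h1, Pi.smul_apply, h2, smul_eq_mul]

theorem inner_hermiteLp (n : ℕ) (g : Lp ℝ 2 (gaussianReal 0 1)) :
    inner ℝ (hermiteLp n) g
      = (√(n.factorial : ℝ))⁻¹ * ∫ x, (realHermite n).eval x * g x ∂(gaussianReal 0 1) := by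
  rw [L2.inner_def, ← integral_const_mul]
  refine integral_congr_ae ?_
  filter_upwards [coeFn_hermiteLp n] with x hx
  rw [hx]
  simp; ring

theorem orthonormal_hermiteLp : Orthonormal ℝ hermiteLp := by
  rw [orthonormal_iff_ite]
  intro m n
  rw [inner_hermiteLp]
  have : ∫ x, (realHermite m).eval x * hermiteLp n x ∂(gaussianReal 0 1)
      = (√(n.factorial : ℝ))⁻¹ *
        ∫ x, (realHermite m).eval x * (realHermite n).eval x ∂(gaussianReal 0 1) := by
    rw [← integral_const_mul]
    refine integral_congr_ae ?_
    filter_upwards [coeFn_hermiteLp n] with x hx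
    rw [hx]; ring
  rw [this, integral_realHermite_mul_realHermite]
  split_ifs with hmn
  · subst hmn
    have h : (0 : ℝ) < m.factorial := by positivity
    have h2 := Real.mul_self_sqrt h.le
    have h3 := (Real.sqrt_pos.2 h).ne'
    field_simp
    linarith [h2]
  · simp

/-- The normalized Hermite polynomials form a Hilbert basis of `L²` of the Gaussian measure. -/
noncomputable def hermiteBasis : HilbertBasis ℕ ℝ (Lp ℝ 2 (gaussianReal 0 1)) :=
  HilbertBasis.mkOfOrthogonalEqBot orthonormal_hermiteLp <| by
    rw [Submodule.eq_bot_iff]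
    intro g hg
    have h (n : ℕ) : ∫ x, (realHermite n).eval x * g x ∂(gaussianReal 0 1) = 0 := by
      have h1 := (Submodule.mem_orthogonal _ _).1 hg (hermiteLp n)
        (Submodule.subset_span ⟨n, rfl⟩)
      rw [inner_hermiteLp] at h1
      exact (mul_eq_zero.1 h1).resolve_left (by positivity)
    rw [Lp.eq_zero_iff_ae_eq_zero]
    refine (Lp.memLp g).ae_eq_zero_of_integral_pow_mul_eq_zero fun n => ?_
    simpa using integral_eval_mul_eq_zero_of_realHermite (Lp.memLp g) h (X ^ n)

@[simp] theorem hermiteBasis_apply (n : ℕ) : hermiteBasis n = hermiteLp n := by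
  simp [hermiteBasis]

/-! ### Correlated Gaussian pairs and the Mehler expansion. -/

theorem posSemidef_covMatrix {k s : ℝ} (hks : k ^ 2 + s ^ 2 = 1) : (covMatrix k).PosSemidef := by
  have h : covMatrix k = !![1, 0; k, s] * (!![1, 0; k, s])ᴴ := by
    ext i j
    fin_cases i <;> fin_cases j <;> simp [covMatrix, Matrix.mul_apply]
    nlinarith
  rw [h]
  exact Matrix.posSemidef_self_mul_conjTranspose _

/-- A correlated standard Gaussian pair is realized as `(x, k x + s w)` with `x, w` independent. -/
theorem map_prod_eq_multivariateGaussian {k s : ℝ} (hks : k ^ 2 + s ^ 2 = 1) :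
    ((gaussianReal 0 1).prod (gaussianReal 0 1)).map
      (fun z : ℝ × ℝ => (!₂[z.1, k * z.1 + s * z.2] : EuclideanSpace ℝ (Fin 2)))
      = multivariateGaussian 0 (covMatrix k) := by
  have hm : Measurable
      (fun z : ℝ × ℝ => (!₂[z.1, k * z.1 + s * z.2] : EuclideanSpace ℝ (Fin 2))) := by
    fun_prop
  have := Measure.isProbabilityMeasure_map
    (μ := (gaussianReal 0 1).prod (gaussianReal 0 1)) hm.aemeasurable
  refine Measure.ext_of_charFun (funext fun t => ?_)
  rw [charFun_multivariateGaussian (posSemidef_covMatrix hks), charFun_apply,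
    integral_map hm.aemeasurable (by fun_prop)]
  have h : ∀ z : ℝ × ℝ, Complex.exp
      (inner ℝ (!₂[z.1, k * z.1 + s * z.2] : EuclideanSpace ℝ (Fin 2)) t * Complex.I)
      = Complex.exp ((t 0 + k * t 1 : ℝ) * z.1 * Complex.I)
        * Complex.exp ((s * t 1 : ℝ) * z.2 * Complex.I) := by
    intro z
    rw [← Complex.exp_add]
    congr 1
    simp [PiLp.inner_apply, Fin.sum_univ_two]
    ring
  simp_rw [h]
  rw [integral_prod_mul (fun x : ℝ => Complex.exp ((t 0 + k * t 1 : ℝ) * x * Complex.I))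
    (fun x : ℝ => Complex.exp ((s * t 1 : ℝ) * x * Complex.I)),
    ← charFun_apply_real, ← charFun_apply_real, charFun_gaussianReal, charFun_gaussianReal,
    ← Complex.exp_add]
  congr 1
  have hks' : (k : ℂ) ^ 2 + (s : ℂ) ^ 2 = 1 := by exact_mod_cast hks
  simp [covMatrix, Matrix.mulVec, dotProduct, Fin.sum_univ_two]
  linear_combination (-(t 1 : ℂ) ^ 2 / 2) * hks'

/-- This is the second marginal of the pair. It makes `g ↦ g (k x + s w)` an `L²` isometry that
respects almost everywhere equality. -/
theorem measurePreserving_mul_add_mul {k s : ℝ} (hks : k ^ 2 + s ^ 2 = 1) :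
    MeasurePreserving (fun z : ℝ × ℝ => k * z.1 + s * z.2)
      ((gaussianReal 0 1).prod (gaussianReal 0 1)) (gaussianReal 0 1) where
  measurable := by fun_prop
  map_eq := by
    have h := (measurePreserving_eval_multivariateGaussian (μ := 0)
      (posSemidef_covMatrix hks) (i := 1)).map_eq
    rw [← map_prod_eq_multivariateGaussian hks, Measure.map_map (by fun_prop) (by fun_prop)] at h
    simpa [covMatrix, Function.comp_def] using h

theorem gaussPairMean_mul {k s : ℝ} (hks : k ^ 2 + s ^ 2 = 1) {f g : ℝ → ℝ}
    (hf : AEStronglyMeasurable f (gaussianReal 0 1))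
    (hg : AEStronglyMeasurable g (gaussianReal 0 1)) :
    gaussPairMean k (fun z₁ z₂ => f z₁ * g z₂)
      = ∫ z : ℝ × ℝ, f z.1 * g (k * z.1 + s * z.2)
          ∂((gaussianReal 0 1).prod (gaussianReal 0 1)) := by
  have h0 := measurePreserving_eval_multivariateGaussian (μ := 0)
    (posSemidef_covMatrix hks) (i := 0)
  have h1 := measurePreserving_eval_multivariateGaussian (μ := 0)
    (posSemidef_covMatrix hks) (i := 1)
  have hm : AEStronglyMeasurable (fun z : EuclideanSpace ℝ (Fin 2) => f (z 0) * g (z 1))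
      (multivariateGaussian 0 (covMatrix k)) := by
    simp only [covMatrix, Matrix.of_apply, Matrix.cons_val', Matrix.cons_val_zero,
      Matrix.cons_val_fin_one, Matrix.cons_val_one, PiLp.zero_apply, Real.toNNReal_one] at h0 h1
    exact (hf.comp_measurePreserving h0).mul (hg.comp_measurePreserving h1)
  rw [gaussPairMean, ← map_prod_eq_multivariateGaussian hks, integral_map (by fun_prop)]
  · simp
  · rwa [map_prod_eq_multivariateGaussian hks]

/-- The Gaussian bilinear form with correlation `k`, tested against a Hermite polynomial. -/
theorem integral_prod_mul_realHermite {k s : ℝ} (hks : k ^ 2 + s ^ 2 = 1) {f : ℝ → ℝ}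
    (hf : MemLp f 2 (gaussianReal 0 1)) (n : ℕ) :
    ∫ z : ℝ × ℝ, f z.1 * (realHermite n).eval (k * z.1 + s * z.2)
          ∂((gaussianReal 0 1).prod (gaussianReal 0 1))
      = k ^ n * ∫ x, (realHermite n).eval x * f x ∂(gaussianReal 0 1) := by
  have h1 := hf.comp_measurePreserving
    (measurePreserving_fst (μ := gaussianReal 0 1) (ν := gaussianReal 0 1))
  have h2 := (memLp_eval_gaussianReal (realHermite n)).comp_measurePreserving
    (measurePreserving_mul_add_mul hks)
  refine (integral_prod _ (h1.integrable_mul h2)).trans ?_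
  rw [← integral_const_mul]
  refine integral_congr_ae (ae_of_all _ fun x => ?_)
  simp only [Pi.mul_apply, Function.comp_apply]
  rw [integral_const_mul, integral_realHermite_affine hks]
  ring

/-- Only the second factor is expanded: the continuous functional `g ↦ ⟨f(x), g(k x + s w)⟩` is
applied to the Hermite expansion of `f`. No bound `|k| < 1` is needed, so the endpoints are covered.
-/
theorem hasSum_integral_prod_mul {k s : ℝ} (hks : k ^ 2 + s ^ 2 = 1) {f : ℝ → ℝ}
    (hf : MemLp f 2 (gaussianReal 0 1)) :
    HasSum (fun n : ℕ => (∫ x, (realHermite n).eval x * f x ∂(gaussianReal 0 1)) ^ 2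
        / n.factorial * k ^ n)
      (∫ z : ℝ × ℝ, f z.1 * f (k * z.1 + s * z.2)
          ∂((gaussianReal 0 1).prod (gaussianReal 0 1))) := by
  have p1 := measurePreserving_fst (μ := gaussianReal 0 1) (ν := gaussianReal 0 1)
  have p2 := measurePreserving_mul_add_mul hks
  have key (g : Lp ℝ 2 (gaussianReal 0 1)) (g' : ℝ → ℝ) (hg : g =ᵐ[gaussianReal 0 1] g') :
      inner ℝ (Lp.compMeasurePreservingₗᵢ ℝ _ p1 hf.toLp) (Lp.compMeasurePreservingₗᵢ ℝ _ p2 g)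
        = ∫ z : ℝ × ℝ, f z.1 * g' (k * z.1 + s * z.2)
          ∂((gaussianReal 0 1).prod (gaussianReal 0 1)) := by
    rw [L2.inner_def]
    refine integral_congr_ae ?_
    filter_upwards [Lp.coeFn_compMeasurePreserving hf.toLp p1,
      Lp.coeFn_compMeasurePreserving g p2, p1.quasiMeasurePreserving.ae_eq_comp hf.coeFn_toLp,
      p2.quasiMeasurePreserving.ae_eq_comp hg] with z h1 h2 h3 h4
    simp only [Function.comp_apply] at h1 h2 h3 h4
    simp only [Lp.compMeasurePreservingₗᵢ_apply_coe, RCLike.inner_apply, conj_trivial]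
    simp only [Lp.compMeasurePreserving_val] at h1 h2
    rw [h1, h2, h3, h4, mul_comm]
  have h := (hermiteBasis.hasSum_repr hf.toLp).mapL
    ((innerSL ℝ (Lp.compMeasurePreservingₗᵢ ℝ _ p1 hf.toLp)).comp
      (Lp.compMeasurePreservingₗᵢ ℝ _ p2).toContinuousLinearMap)
  simp only [ContinuousLinearMap.comp_apply, LinearIsometry.coe_toContinuousLinearMap,
    innerSL_apply_apply] at h
  rw [key _ _ hf.coeFn_toLp] at h
  refine Eq.mp (congrArg (HasSum · _) (funext fun n => ?_)) h
  rw [map_smul, inner_smul_right, HilbertBasis.repr_apply_apply, hermiteBasis_apply,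
    inner_hermiteLp, key _ _ (coeFn_hermiteLp n)]
  have e1 : ∫ x, (realHermite n).eval x * hf.toLp f x ∂(gaussianReal 0 1)
      = ∫ x, (realHermite n).eval x * f x ∂(gaussianReal 0 1) := by
    refine integral_congr_ae ?_
    filter_upwards [hf.coeFn_toLp] with x hx
    rw [hx]
  simp_rw [mul_left_comm (f _)]
  rw [e1, integral_const_mul, integral_prod_mul_realHermite hks hf]
  have h0 : (0 : ℝ) < n.factorial := by positivity
  have h2 := Real.sq_sqrt h0.le
  have h3 := (Real.sqrt_pos.2 h0).ne'
  field_simp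
  rw [h2]
  ring

/-- A square integrable function whose Hermite coefficients of order at least two vanish
is almost everywhere affine. -/
theorem exists_ae_eq_affine_of_realHermite {f : ℝ → ℝ} (hf : MemLp f 2 (gaussianReal 0 1))
    (h : ∀ n, 2 ≤ n → ∫ x, (realHermite n).eval x * f x ∂(gaussianReal 0 1) = 0) :
    ∃ a b : ℝ, ∀ᵐ z ∂(gaussianReal 0 1), f z = a * z + b := by
  have hr : ∀ n ∉ Finset.range 2, hermiteBasis.repr hf.toLp n • hermiteBasis n = 0 := by
    intro n hn
    rw [HilbertBasis.repr_apply_apply, hermiteBasis_apply, inner_hermiteLp]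
    have e1 : ∫ x, (realHermite n).eval x * hf.toLp f x ∂(gaussianReal 0 1)
        = ∫ x, (realHermite n).eval x * f x ∂(gaussianReal 0 1) := by
      refine integral_congr_ae ?_
      filter_upwards [hf.coeFn_toLp] with x hx
      rw [hx]
    rw [e1, h n (not_lt.1 (Finset.mem_range.not.1 hn))]
    simp
  have hs := (hermiteBasis.hasSum_repr hf.toLp).unique (hasSum_sum_of_ne_finset_zero hr)
  simp only [Finset.sum_range_succ, Finset.sum_range_zero, zero_add, hermiteBasis_apply] at hs
  set c0 := hermiteBasis.repr hf.toLp 0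
  set c1 := hermiteBasis.repr hf.toLp 1
  refine ⟨c1, c0, ?_⟩
  filter_upwards [hf.coeFn_toLp, coeFn_hermiteLp 0, coeFn_hermiteLp 1,
    Lp.coeFn_add (c0 • hermiteLp 0) (c1 • hermiteLp 1), Lp.coeFn_smul c0 (hermiteLp 0),
    Lp.coeFn_smul c1 (hermiteLp 1)] with x h1 h2 h3 h4 h5 h6
  rw [← h1, hs, h4, Pi.add_apply, h5, h6, Pi.smul_apply, Pi.smul_apply, h2, h3]
  simp
  ring

end GaussianHermite

/-! ### Iteration of power series with nonnegative coefficients. -/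

section PowerSeriesDynamics

variable {p : ℕ → ℝ} {C : ℝ → ℝ}

theorem continuousOn_of_hasSum_pow (hp : ∀ n, 0 ≤ p n)
    (hC : ∀ k ∈ Set.Icc (-1 : ℝ) 1, HasSum (fun n => p n * k ^ n) (C k)) :
    ContinuousOn C (Set.Icc (-1) 1) := by
  have hs : Summable p := by simpa using (hC 1 (by simp)).summable
  refine (continuousOn_tsum (f := fun n k => p n * k ^ n) (fun n => by fun_prop) hs
    fun n k hk => ?_).congr fun k hk => (hC k hk).tsum_eq.symm
  rw [norm_mul, norm_pow, Real.norm_of_nonneg (hp n)]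
  exact mul_le_of_le_one_right (hp n) (pow_le_one₀ (norm_nonneg _) (abs_le.2 hk))

/-- Every term is convex on `[0, 1]`, and the term of order `j ≥ 2` is strictly so. -/
theorem strictConvexOn_of_hasSum_pow (hp : ∀ n, 0 ≤ p n)
    (hC : ∀ k ∈ Set.Icc (-1 : ℝ) 1, HasSum (fun n => p n * k ^ n) (C k))
    {j : ℕ} (hj : 2 ≤ j) (hpj : 0 < p j) : StrictConvexOn ℝ (Set.Icc 0 1) C := by
  have hsub : Set.Icc (0 : ℝ) 1 ⊆ Set.Icc (-1) 1 := Set.Icc_subset_Icc_left (by norm_num)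
  refine ⟨convex_Icc 0 1, fun x hx y hy hxy a b ha hb hab => ?_⟩
  have hz := convex_Icc (0 : ℝ) 1 hx hy ha.le hb.le hab
  have hr := ((hC x (hsub hx)).mul_left a).add ((hC y (hsub hy)).mul_left b)
  refine hasSum_lt (fun n => ?_) (i := j) ?_ (hC _ (hsub hz)) hr
  · have := (convexOn_pow n).2 (x := x) hx.1 (y := y) hy.1 ha.le hb.le hab
    have := mul_le_mul_of_nonneg_left this (hp n)
    simp only [smul_eq_mul] at this ⊢
    linarith
  · have := (strictConvexOn_pow hj).2 (x := x) hx.1 (y := y) hy.1 hxy ha hb hab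
    have := mul_lt_mul_of_pos_left this hpj
    simp only [smul_eq_mul] at this ⊢
    linarith

theorem monotoneOn_of_hasSum_pow (hp : ∀ n, 0 ≤ p n)
    (hC : ∀ k ∈ Set.Icc (-1 : ℝ) 1, HasSum (fun n => p n * k ^ n) (C k)) :
    MonotoneOn C (Set.Icc 0 1) := fun x hx y hy hxy =>
  hasSum_le (fun n => mul_le_mul_of_nonneg_left (pow_le_pow_left₀ hx.1 hxy n) (hp n))
    (hC x ⟨by linarith [hx.1], hx.2⟩) (hC y ⟨by linarith [hy.1], hy.2⟩)

theorem abs_lt_one_of_hasSum_pow (hp : ∀ n, 0 ≤ p n)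
    (hC : ∀ k ∈ Set.Icc (-1 : ℝ) 1, HasSum (fun n => p n * k ^ n) (C k)) (h1 : C 1 = 1)
    {j : ℕ} (hj : 2 ≤ j) (hpj : 0 < p j) {k : ℝ} (hk : k ∈ Set.Ioo (-1 : ℝ) 1) :
    C k ∈ Set.Ioo (-1 : ℝ) 1 := by
  have hk1 : |k| < 1 := abs_lt.2 hk
  have hs := hC 1 (by simp)
  have hle (n : ℕ) : |p n * k ^ n| ≤ p n := by
    rw [abs_mul, abs_pow, abs_of_nonneg (hp n)]
    exact mul_le_of_le_one_right (hp n) (pow_le_one₀ (abs_nonneg k) hk1.le)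
  have hlt : |p j * k ^ j| < p j := by
    rw [abs_mul, abs_pow, abs_of_nonneg (hp j)]
    exact mul_lt_of_lt_one_right hpj (pow_lt_one₀ (abs_nonneg k) hk1 (by omega))
  simp only [one_pow, mul_one, h1] at hs
  have hk' := hC k ⟨hk.1.le, hk.2.le⟩
  exact ⟨hasSum_lt (fun n => (abs_le.1 (hle n)).1) (abs_lt.1 hlt).1 hs.neg hk',
    hasSum_lt (fun n => (abs_le.1 (hle n)).2) (abs_lt.1 hlt).2 hk' hs⟩

/-- Since the `p n` sum to `1`, compare with `k = ∑ p n * k`. For `n ≥ 1`, `k^n ≥ -|k|^n ≥ -|k| =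
k`, strictly at `j ≥ 2`; the constant term has `1 > k`. -/
theorem lt_map_of_neg_of_hasSum_pow (hp : ∀ n, 0 ≤ p n)
    (hC : ∀ k ∈ Set.Icc (-1 : ℝ) 1, HasSum (fun n => p n * k ^ n) (C k)) (h1 : C 1 = 1)
    {j : ℕ} (hj : 2 ≤ j) (hpj : 0 < p j) {k : ℝ} (hk : k ∈ Set.Ioo (-1 : ℝ) 0) : k < C k := by
  have hs := (hC 1 (by simp)).mul_right k
  simp only [one_pow, mul_one, h1, one_mul] at hs
  have habs : |k| = -k := abs_of_neg hk.2
  have hk0 : 0 < |k| := abs_pos.2 hk.2.ne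
  have hk1 : |k| < 1 := by linarith [hk.1]
  refine hasSum_lt (fun n => ?_) (i := j) ?_ hs (hC k ⟨hk.1.le, by linarith [hk.2]⟩)
  · refine mul_le_mul_of_nonneg_left ?_ (hp n)
    rcases Nat.eq_zero_or_pos n with rfl | hn
    · simp only [pow_zero]; linarith [hk.2]
    · have := neg_abs_le (k ^ n)
      rw [abs_pow] at this
      have := pow_le_of_le_one (abs_nonneg k) hk1.le hn.ne'
      linarith
  · refine mul_lt_mul_of_pos_left ?_ hpj
    have := neg_abs_le (k ^ j)
    rw [abs_pow] at this
    have := pow_lt_self_of_lt_one₀ hk0 hk1 (by omega : 1 < j)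
    linarith

theorem isFixedPt_of_continuousOn_of_tendsto_iterate {s : Set ℝ} (hc : ContinuousOn C s) {x l : ℝ}
    (hx : ∀ m, C^[m] x ∈ s) (hl : l ∈ s) (h : Tendsto (fun m => C^[m] x) atTop (𝓝 l)) :
    Function.IsFixedPt C l := by
  have h2 : Tendsto (fun m => C (C^[m] x)) atTop (𝓝 (C l)) :=
    (hc l hl).tendsto.comp (tendsto_nhdsWithin_iff.2 ⟨h, Eventually.of_forall hx⟩)
  simp_rw [← Function.iterate_succ_apply' C] at h2
  exact tendsto_nhds_unique h2 ((tendsto_add_atTop_iff_nat 1).2 h)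

theorem exists_fixedPt_tendsto_iterate_of_le_map {a b x : ℝ} (hc : ContinuousOn C (Set.Icc a b))
    (hx : ∀ m, C^[m] x ∈ Set.Icc a b) (hle : ∀ m, C^[m] x ≤ C (C^[m] x)) :
    ∃ l ∈ Set.Icc a b, Function.IsFixedPt C l ∧ Tendsto (fun m => C^[m] x) atTop (𝓝 l) := by
  have hm : Monotone fun m => C^[m] x := monotone_nat_of_le_succ fun m => by
    rw [Function.iterate_succ_apply']; exact hle m
  have hl := tendsto_atTop_ciSup hm ⟨b, by rintro _ ⟨m, rfl⟩; exact (hx m).2⟩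
  have hmem := isClosed_Icc.mem_of_tendsto hl (Eventually.of_forall hx)
  exact ⟨_, hmem, isFixedPt_of_continuousOn_of_tendsto_iterate hc hx hmem hl, hl⟩

theorem exists_fixedPt_tendsto_iterate_of_map_le {a b x : ℝ} (hc : ContinuousOn C (Set.Icc a b))
    (hx : ∀ m, C^[m] x ∈ Set.Icc a b) (hle : ∀ m, C (C^[m] x) ≤ C^[m] x) :
    ∃ l ∈ Set.Icc a b, Function.IsFixedPt C l ∧ Tendsto (fun m => C^[m] x) atTop (𝓝 l) := by
  have hm : Antitone fun m => C^[m] x := antitone_nat_of_succ_le fun m => by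
    rw [Function.iterate_succ_apply']; exact hle m
  have hl := tendsto_atTop_ciInf hm ⟨a, by rintro _ ⟨m, rfl⟩; exact (hx m).1⟩
  have hmem := isClosed_Icc.mem_of_tendsto hl (Eventually.of_forall hx)
  exact ⟨_, hmem, isFixedPt_of_continuousOn_of_tendsto_iterate hc hx hmem hl, hl⟩

/-- A strictly convex self-map of `[0, 1]` fixing `1` has a fixed point separating the points
moved up from the points of `[0, 1)` moved down. -/
theorem StrictConvexOn.exists_fixedPt_separating (hconv : StrictConvexOn ℝ (Set.Icc 0 1) C)
    (hc : ContinuousOn C (Set.Icc 0 1)) (h0 : 0 ≤ C 0) (h1 : C 1 = 1) :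
    ∃ u ∈ Set.Icc (0 : ℝ) 1, Function.IsFixedPt C u ∧ (∀ x ∈ Set.Ico 0 u, x < C x) ∧
      ∀ x ∈ Set.Ioo u 1, C x < x := by
  -- Strict convexity on the chord from `x` to `1`, cleared of denominators: `(1 - C x) / (1 - x)`
  -- is strictly increasing, and it equals `1` exactly at fixed points.
  have key {x y : ℝ} (hx : 0 ≤ x) (hxy : x < y) (hy : y < 1) :
      C y * (1 - x) < C x * (1 - y) + (y - x) := by
    have hpos : 0 < 1 - x := by linarith
    have h := hconv.2 (show x ∈ Set.Icc 0 1 from ⟨hx, by linarith⟩)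
      (show (1 : ℝ) ∈ Set.Icc 0 1 by simp) (by linarith)
      (show 0 < (1 - y) / (1 - x) from div_pos (by linarith) hpos)
      (show 0 < (y - x) / (1 - x) from div_pos (by linarith) hpos) (by field_simp; ring)
    have e : ((1 - y) / (1 - x)) • x + ((y - x) / (1 - x)) • (1 : ℝ) = y := by
      simp only [smul_eq_mul]; field_simp; ring
    rw [e, h1] at h
    have h2 := mul_lt_mul_of_pos_right h hpos
    have e2 : (((1 - y) / (1 - x)) • C x + ((y - x) / (1 - x)) • (1 : ℝ)) * (1 - x)
        = C x * (1 - y) + (y - x) := by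
      simp only [smul_eq_mul]; field_simp
    rwa [e2] at h2
  by_cases hex : ∃ u ∈ Set.Ico (0 : ℝ) 1, C u = u
  · obtain ⟨u, hu, hfix⟩ := hex
    refine ⟨u, ⟨hu.1, hu.2.le⟩, hfix, fun x hx => ?_, fun x hx => ?_⟩
    · have := key hx.1 hx.2 hu.2
      rw [hfix] at this
      have hpos : 0 < 1 - u := by linarith [hu.2]
      nlinarith
    · have := key hu.1 hx.1 hx.2
      rw [hfix] at this
      have hpos : 0 < 1 - u := by linarith [hu.2]
      nlinarith
  · push Not at hex
    refine ⟨1, by simp, h1, fun x hx => ?_, fun x hx => absurd hx.1 (by linarith [hx.2])⟩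
    by_contra! hle
    -- As `C 0 ≥ 0`, a point with `C x ≤ x` would force a fixed point in `[0, x]`.
    have hcx : ContinuousOn (fun y => C y - y) (Set.Icc 0 x) :=
      (hc.mono (Set.Icc_subset_Icc_right hx.2.le)).sub continuousOn_id
    obtain ⟨y, hy, hy0⟩ := intermediate_value_Icc' hx.1 hcx
      (show (0 : ℝ) ∈ Set.Icc (C x - x) (C 0 - 0) from ⟨by linarith, by linarith⟩)
    exact hex y ⟨hy.1, hy.2.trans_lt hx.2⟩ (sub_eq_zero.1 hy0)

/-- Dynamics of a nonaffine probability generating function on `(-1, 1)`. -/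
theorem exists_attracting_fixedPt_of_hasSum_pow (hp : ∀ n, 0 ≤ p n)
    (hC : ∀ k ∈ Set.Icc (-1 : ℝ) 1, HasSum (fun n => p n * k ^ n) (C k)) (h1 : C 1 = 1)
    {j : ℕ} (hj : 2 ≤ j) (hpj : 0 < p j) :
    ∃ u ∈ Set.Icc (0 : ℝ) 1, Function.IsFixedPt C u ∧
      (∀ k ∈ Set.Ioo (-1 : ℝ) 1, Tendsto (fun m : ℕ => C^[m] k) atTop (𝓝 u)) ∧
      (∀ k ∈ Set.Ioo (-1 : ℝ) 1, Function.IsFixedPt C k → k = u) ∧ (u = 0 ↔ C 0 = 0) := by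
  have hc := continuousOn_of_hasSum_pow hp hC
  have hmono := monotoneOn_of_hasSum_pow hp hC
  have hC0 : 0 ≤ C 0 :=
    (hC 0 (by simp)).nonneg fun n => mul_nonneg (hp n) (pow_nonneg le_rfl n)
  have hmaps : Set.MapsTo C (Set.Ioo (-1) 1) (Set.Ioo (-1) 1) := fun k hk =>
    abs_lt_one_of_hasSum_pow hp hC h1 hj hpj hk
  have hneg : ∀ k ∈ Set.Ioo (-1 : ℝ) 0, k < C k := fun k hk =>
    lt_map_of_neg_of_hasSum_pow hp hC h1 hj hpj hk
  have hnn : ∀ k ∈ Set.Icc (0 : ℝ) 1, 0 ≤ C k := fun k hk =>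
    hC0.trans (hmono (by simp) hk hk.1)
  obtain ⟨u, hu, hfix, hup, hdown⟩ := (strictConvexOn_of_hasSum_pow hp hC hj hpj)
    |>.exists_fixedPt_separating (hc.mono (Set.Icc_subset_Icc_left (by norm_num))) hC0 h1
  have huniq : ∀ k ∈ Set.Ioo (-1 : ℝ) 1, Function.IsFixedPt C k → k = u := by
    intro k hk hkf
    rcases lt_or_ge k 0 with h0 | h0
    · exact absurd hkf (hneg k ⟨hk.1, h0⟩).ne'
    · rcases lt_trichotomy k u with h | h | h
      · exact absurd hkf (hup k ⟨h0, h⟩).ne'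
      · exact h
      · exact absurd hkf (hdown k ⟨h, hk.2⟩).ne
  -- The interval between `k` and `u` is invariant and the orbit moves monotonically towards `u`.
  -- Its limit is a fixed point there, which can only be `u`.
  have hpos : ∀ k ∈ Set.Ico (0 : ℝ) 1, Tendsto (fun m : ℕ => C^[m] k) atTop (𝓝 u) := by
    intro k hk
    rcases le_or_gt k u with hku | hku
    · have hM : Set.MapsTo C (Set.Icc k u) (Set.Icc k u) := fun x hx => by
        refine ⟨?_, hfix ▸ hmono ⟨hk.1.trans hx.1, hx.2.trans hu.2⟩ hu hx.2⟩
        rcases hx.2.lt_or_eq with h | rfl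
        · exact hx.1.trans (hup x ⟨hk.1.trans hx.1, h⟩).le
        · exact hku.trans hfix.ge
      have hit := fun m => hM.iterate m (Set.left_mem_Icc.2 hku)
      obtain ⟨l, hl, hlf, hlt⟩ := exists_fixedPt_tendsto_iterate_of_le_map
        (hc.mono (Set.Icc_subset_Icc (by linarith [hk.1]) hu.2)) hit fun m => by
          rcases (hit m).2.lt_or_eq with h | h
          · exact (hup _ ⟨hk.1.trans (hit m).1, h⟩).le
          · rw [h, hfix]
      rcases hl.2.lt_or_eq with h | rfl
      · exact absurd hlf (hup l ⟨hk.1.trans hl.1, h⟩).ne'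
      · exact hlt
    · have hle : ∀ x ∈ Set.Icc u k, C x ≤ x := fun x hx => by
        rcases hx.1.lt_or_eq with h | rfl
        · exact (hdown x ⟨h, hx.2.trans_lt hk.2⟩).le
        · exact hfix.le
      have hM : Set.MapsTo C (Set.Icc u k) (Set.Icc u k) := fun x hx =>
        ⟨hfix ▸ hmono hu ⟨hu.1.trans hx.1, hx.2.trans hk.2.le⟩ hx.1, (hle x hx).trans hx.2⟩
      have hit := fun m => hM.iterate m (Set.right_mem_Icc.2 hku.le)
      obtain ⟨l, hl, hlf, hlt⟩ := exists_fixedPt_tendsto_iterate_of_map_le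
        (hc.mono (Set.Icc_subset_Icc (by linarith [hu.1]) hk.2.le)) hit fun m => hle _ (hit m)
      rcases hl.1.lt_or_eq with h | rfl
      · exact absurd hlf (hdown l ⟨h, hl.2.trans_lt hk.2⟩).ne
      · exact hlt
  refine ⟨u, hu, hfix, fun k hk => ?_, huniq, fun h => by rw [h] at hfix; exact hfix,
    fun h => (huniq 0 (by norm_num) h).symm⟩
  -- Either the orbit becomes nonnegative and its tail is covered by `hpos`, or it stays negative
  -- and increases to a fixed point in `[k, 0]`.
  by_cases hex : ∃ m, 0 ≤ C^[m] k
  · obtain ⟨m, hm⟩ := hex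
    have := hpos _ ⟨hm, (hmaps.iterate m hk).2⟩
    simp_rw [← Function.iterate_add_apply] at this
    exact (tendsto_add_atTop_iff_nat m).1 this
  · push Not at hex
    have hge : ∀ m, C^[m] k ≤ C (C^[m] k) := fun m =>
      (hneg _ ⟨(hmaps.iterate m hk).1, hex m⟩).le
    have hkm : ∀ m, k ≤ C^[m] k := fun m => by
      induction m with
      | zero => exact le_rfl
      | succ m ih =>
        rw [Function.iterate_succ_apply']
        exact ih.trans (hge m)
    obtain ⟨l, hl, hlf, hlt⟩ := exists_fixedPt_tendsto_iterate_of_le_map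
      (hc.mono (Set.Icc_subset_Icc hk.1.le zero_le_one)) (fun m => ⟨hkm m, (hex m).le⟩) hge
    rwa [← huniq l ⟨hk.1.trans_le hl.1, hl.2.trans_lt one_pos⟩ hlf]

end PowerSeriesDynamics

/-! ### Application to the covariance map. -/

theorem gaussMean_sq_pos {f : ℝ → ℝ} (hf : MemLp f 2 (gaussianReal 0 1))
    (h0 : ¬ f =ᵐ[gaussianReal 0 1] 0) : 0 < gaussMean (fun z => f z ^ 2) := by
  refine lt_of_le_of_ne (integral_nonneg fun _ => sq_nonneg _) fun h => h0 ?_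
  have := (integral_eq_zero_iff_of_nonneg (fun _ => sq_nonneg _) hf.integrable_sq).1 h.symm
  filter_upwards [this] with x hx
  simpa using hx

theorem hermiteCoeff_eq (f : ℝ → ℝ) (n : ℕ) :
    hermiteCoeff f n
      = (∫ x, (realHermite n).eval x * f x ∂(gaussianReal 0 1)) / n.factorial := by
  simp only [hermiteCoeff, gaussMean, aeval_hermite_eq_eval, mul_comm]

theorem hasSum_covMap {σ : ℝ → ℝ} (hσ : MemLp σ 2 (gaussianReal 0 1)) {k : ℝ}
    (hk : k ∈ Set.Icc (-1 : ℝ) 1) :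
    HasSum (fun n : ℕ =>
        hermiteCoeff σ n ^ 2 * (n.factorial : ℝ) * k ^ n / gaussMean (fun z => σ z ^ 2))
      (covMap σ k) := by
  have hks : k ^ 2 + √(1 - k ^ 2) ^ 2 = 1 := by
    rw [Real.sq_sqrt (by nlinarith [hk.1, hk.2])]; ring
  have h := (hasSum_integral_prod_mul hks hσ).div_const (gaussMean fun z => σ z ^ 2)
  rw [← gaussPairMean_mul hks hσ.1 hσ.1] at h
  refine Eq.mp (congrArg (HasSum · _) (funext fun n => ?_)) h
  rw [hermiteCoeff_eq]
  have : (n.factorial : ℝ) ≠ 0 := by positivity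
  field_simp

theorem covMap_one {σ : ℝ → ℝ} (hσ : MemLp σ 2 (gaussianReal 0 1))
    (h0 : 0 < gaussMean (fun z => σ z ^ 2)) : covMap σ 1 = 1 := by
  have h : gaussPairMean 1 (fun z₁ z₂ => σ z₁ * σ z₂) = gaussMean (fun z => σ z ^ 2) := by
    -- At `k = 1` the independent component has weight `s = 0`, so both variables coincide.
    rw [gaussPairMean_mul (s := 0) (by norm_num) hσ.1 hσ.1, gaussMean]
    simp only [one_mul, zero_mul, add_zero, ← pow_two]
    rw [integral_fun_fst (μ := gaussianReal 0 1) (ν := gaussianReal 0 1) (fun x => σ x ^ 2)]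
    simp
  rw [covMap, h, div_self h0.ne']

theorem lemma4p4 (σ : ℝ → ℝ)
    -- `σ` is square integrable under the Gaussian measure
    (hσ : MemLp σ 2 (gaussianReal 0 1))
    -- `σ` is nonaffine, as an element of `L²` of the Gaussian measure
    (hna : ¬ ∃ a b : ℝ, ∀ᵐ z ∂(gaussianReal 0 1), σ z = a * z + b) :
    -- the covariance map is given on `[-1, 1]` by its Hermite power series
    (∀ k ∈ Set.Icc (-1 : ℝ) 1,
      HasSum
        (fun n : ℕ =>
          hermiteCoeff σ n ^ 2 * (n.factorial : ℝ) * k ^ n / gaussMean (fun z => σ z ^ 2))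
        (covMap σ k)) ∧
    ∃ kstar ∈ Set.Icc (0 : ℝ) 1,
      Function.IsFixedPt (covMap σ) kstar ∧
      -- every starting point is attracted to the same fixed point
      (∀ k₀ ∈ Set.Ioo (-1 : ℝ) 1,
        Tendsto (fun m : ℕ => (covMap σ)^[m] k₀) atTop (𝓝 kstar)) ∧
      -- no other fixed point lies in `(-1, 1)`
      (∀ k ∈ Set.Ioo (-1 : ℝ) 1, Function.IsFixedPt (covMap σ) k → k = kstar) ∧
      (kstar = 0 ↔ gaussMean σ = 0) := by
  refine ⟨fun k hk => hasSum_covMap hσ hk, ?_⟩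
  have hσ0 : 0 < gaussMean (fun z => σ z ^ 2) := gaussMean_sq_pos hσ fun h =>
    hna ⟨0, 0, h.mono fun z hz => by simpa using hz⟩
  obtain ⟨j, hj, hj0⟩ : ∃ j, 2 ≤ j ∧
      ∫ x, (realHermite j).eval x * σ x ∂(gaussianReal 0 1) ≠ 0 := by
    by_contra! h
    exact hna (exists_ae_eq_affine_of_realHermite hσ h)
  have hC : ∀ k ∈ Set.Icc (-1 : ℝ) 1, HasSum (fun n : ℕ => hermiteCoeff σ n ^ 2 *
      (n.factorial : ℝ) / gaussMean (fun z => σ z ^ 2) * k ^ n) (covMap σ k) := fun k hk =>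
    by simpa only [mul_div_right_comm] using hasSum_covMap hσ hk
  have hjpos : hermiteCoeff σ j ≠ 0 := by
    rw [hermiteCoeff_eq]
    exact div_ne_zero hj0 (by positivity)
  obtain ⟨u, hu, hfix, hlim, huniq, hzero⟩ := exists_attracting_fixedPt_of_hasSum_pow
    (fun n => by positivity) hC (covMap_one hσ hσ0) hj (by positivity)
  refine ⟨u, hu, hfix, hlim, huniq, hzero.trans ?_⟩
  -- At `k = 0` only the term `n = 0` survives, with `0 ^ 0 = 1`; its coefficient is `⟨σ⟩` because
  -- `He_0 = 1`.
  have h0 : covMap σ 0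
      = hermiteCoeff σ 0 ^ 2 * ((0 : ℕ).factorial : ℝ) / gaussMean (fun z => σ z ^ 2) := by
    refine (hC 0 (by simp)).unique ?_
    convert hasSum_single 0 fun n hn => ?_ using 1
    · simp
    · simp [hn]
  rw [h0, hermiteCoeff_eq, div_eq_zero_iff, or_iff_left hσ0.ne']
  simp [gaussMean]
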